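/- Consider a $K$ user ADT deterministic interference network with $M$ parallel sub-channels and non-negative integer channel strength levels $n_{ki}^{[m]}$ (from Transmitter $i$ to Receiver $k$, $i,k\in[K]$, $m\in[M]$): in each channel use Transmitter $i$ sends real numbers $X_i^{[m]}=0.X_{i,(1)}^{[m]}X_{i,(2)}^{[m]}\ldots$ (base two, in $[0,1)$), and Receiver $k$ observes $$Y_k^{[m]}=\lfloor 2^{n_{k1}^{[m]}}X_1^{[m]}\rfloor\oplus\cdots\oplus\lfloor 2^{n_{kK}^{[m]}}X_K^{[m]}\rfloor,\qquad m\in[M],$$ where $\oplus$ is bit-wise addition modulo two. The capacity region is the closure of the set of tuples $(R_1,\ldots,R_K)$ of non-negative rates for which there are codes of block length $N$ with independent, uniformly distributed messages, $\lceil 2^{NR_i}\rceil$ for user $i$, whose error probability at each receiver tends to $0$ as $N\to\infty$; the sum-capacity is the maximum of $\sum_k R_k$ over the capacity region. Suppose that each sub-channel is TIN optimal, i.e. $n_{ii}^{[m]}\ge \max_{j\ne i}n_{ji}^{[m]}+\max_{k\ne i}n_{ik}^{[m]}$ for all $i\in[K]$. A cyclic partition $\Pi$ is a cover of the users by disjoint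 cycles; $\Pi(k)$ is the cyclic predecessor of user $k$ in its cycle, which exists if that cycle is non-trivial, i.e. has more than one user. The weight of $\Pi$ on sub-channel $m$ is $w(\Pi)=\sum_k n_{\Pi(k)k}^{[m]}$, summed over the users $k$ in non-trivial cycles, and $\Pi$ is optimal if it minimizes the bound $\sum_k n_{kk}^{[m]}-w(\Pi)$. For each $m$ let $\Pi^{[m]*}$ be an optimal cyclic partition of sub-channel $m$, and suppose that it is dominant: for every user $k$ in a non-trivial cycle of $\Pi^{[m]*}$, $$n_{\Pi^{[m]*}(k)k}^{[m]}>n_{jk}^{[m]}\qquad\text{for all } j\in[K]\setminus\{k,\Pi^{[m]*}(k)\}.$$ Then: (a) Every sub-channel $m$ is invertible under $\Pi^{[m]*}$: let $X_{i,u}^{[m]}$ be $0.X_{i,(1)}^{[m]}\ldots X_{i,(l)}^{[m]}$ with $l=n_{\Pi^{[m]*}(i)i}^{[m]}$ (and $l=0$ if $i$ is in a trivial cycle), and $Y_{k,u}^{[m]}=\bigoplus_{i\ne k}\lfloor 2^{n_{ki}^{[m]}}X_{i,u}^{[m]}\rfloor$; then $(Y_{1,u}^{[m]},\ldots,Y_{K,u}^{[m]})$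 determines $(X_{1,u}^{[m]},\ldots,X_{K,u}^{[m]})$. (b) Separate TIN achieves the sum-capacity: there are power control levels $s_i^{[m]}\in\{0,1,2,\ldots\}$ with the following property. Over each sub-channel $m$ let the inputs $X_1^{[m]},\ldots,X_K^{[m]}$ be independent, where the first $s_i^{[m]}$ bits of $X_i^{[m]}$ are zero, its bits from there up to level $\max_{k,j} n_{kj}^{[m]}$ are independent and uniform, and all later bits are zero; and let $R_k=\sum_{m=1}^M I(X_k^{[m]};Y_k^{[m]})$ (in bits) be the resulting rates when each receiver treats interference as noise. Then $(R_1,\ldots,R_K)$ is in the capacity region, and $\sum_k R_k$ is the sum-capacity. -/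

import Mathlib

/-! A sub-channel of a `K` user ADT deterministic interference network is given by its matrix of
channel strength levels `n : Fin K → Fin K → ℕ`, where `n k i` is the strength from Transmitter `i`
to Receiver `k`.  A network with `M` parallel sub-channels is a family
`n : Fin M → Fin K → Fin K → ℕ`. -/

namespace ADT

/-- A channel input symbol: a real number with binary expansion `0.X₁X₂X₃…`. -/
abbrev Symbol : Type := Set.Ico (0 : ℝ) 1

/-- Carry-free (bit-wise modulo two) addition of a finite family of natural numbers. -/
def xorSum {ι : Type} (s : Finset ι) (f : ι → ℕ) : ℕ :=
  s.fold (fun a b : ℕ => a ^^^ b) 0 f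

/-- The channel: `Y_k = ⌊2^{n_{k1}} X_1⌋ ⊕ ⋯ ⊕ ⌊2^{n_{kK}} X_K⌋`. -/
noncomputable def output {K : ℕ} (n : Fin K → Fin K → ℕ) (x : Fin K → ℝ) (k : Fin K) : ℕ :=
  xorSum Finset.univ (fun i => ⌊(2 : ℝ) ^ n k i * x i⌋₊)

/-! ### Codes, capacity region, sum-capacity -/

/-- A block code of length `N` over `M` sub-channels, in which user `i` has `W i` messages. -/
structure Code (K M N : ℕ) (W : Fin K → ℕ) where
  /-- the encoders: message, then channel use, then sub-channel -/
  enc : ∀ i : Fin K, Fin (W i) → Fin N → Fin M → Symbol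
  /-- the decoders -/
  dec : ∀ k : Fin K, (Fin N → Fin M → ℕ) → Fin (W k)

namespace Code

variable {K M N : ℕ} {W : Fin K → ℕ}

/-- The block received at Receiver `k` when the message tuple is `w`. -/
noncomputable def received (n : Fin M → Fin K → Fin K → ℕ) (c : Code K M N W)
    (w : ∀ i, Fin (W i)) (k : Fin K) : Fin N → Fin M → ℕ :=
  fun t m => output (n m) (fun i => (c.enc i (w i) t m : ℝ)) k

/-- The error probability at Receiver `k`, for independent uniformly distributed messages. -/
noncomputable def errorProb (n : Fin M → Fin K → Fin K → ℕ) (c : Code K M N W) (k : Fin K) : ℝ :=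
  ((Finset.univ.filter fun w : ∀ i, Fin (W i) => c.dec k (c.received n w k) ≠ w k).card : ℝ) /
    (Fintype.card (∀ i, Fin (W i)) : ℝ)

end Code

/-- The number of messages `⌈2^{N R}⌉` at rate `R` and block length `N`. -/
noncomputable def numMessages (N : ℕ) (R : ℝ) : ℕ := ⌈(2 : ℝ) ^ ((N : ℝ) * R)⌉₊

/-- A tuple of non-negative rates is achievable if some sequence of codes, of block lengths
`N = 0, 1, 2, …`, has error probabilities tending to zero at all receivers. -/
def Achievable {K M : ℕ} (n : Fin M → Fin K → Fin K → ℕ) (R : Fin K → ℝ) : Prop :=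
  (∀ k, 0 ≤ R k) ∧
    ∃ c : ∀ N : ℕ, Code K M N (fun i => numMessages N (R i)),
      ∀ k, Filter.Tendsto (fun N => (c N).errorProb n k) Filter.atTop (nhds 0)

/-- The capacity region: the closure of the set of achievable rate tuples. -/
def capacityRegion {K M : ℕ} (n : Fin M → Fin K → Fin K → ℕ) : Set (Fin K → ℝ) :=
  closure {R | Achievable n R}

/-- `C` is the sum-capacity, the maximum of `R_1 + ⋯ + R_K` over the capacity region. -/
def IsSumCapacity {K M : ℕ} (n : Fin M → Fin K → Fin K → ℕ) (C : ℝ) : Prop :=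
  IsGreatest ((fun R : Fin K → ℝ => ∑ k, R k) '' capacityRegion n) C

/-! ### The TIN optimality condition and cyclic partitions -/

/-- `n_ii ≥ max_{j ≠ i} n_ji + max_{k ≠ i} n_ik` for every user `i`. -/
def TINOptimal {K : ℕ} (n : Fin K → Fin K → ℕ) : Prop :=
  ∀ i j k : Fin K, j ≠ i → k ≠ i → n j i + n i k ≤ n i i

/-- A cyclic partition, i.e. a cover of the users by pairwise disjoint cycles, is a permutation
of the users: `P k` is the cyclic predecessor of user `k`, and the trivial cycles are the fixed
points. -/
abbrev CyclicPartition (K : ℕ) : Type := Equiv.Perm (Fin K)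

/-- The strength of the participating edge that leaves user `i`, which is also the number of
participating input levels of user `i`; zero if user `i` forms a trivial cycle. -/
def edgeWeight {K : ℕ} (n : Fin K → Fin K → ℕ) (P : CyclicPartition K) (i : Fin K) : ℕ :=
  if P i = i then 0 else n (P i) i

/-- The weight `w(Π)` of a cyclic partition. -/
def weight {K : ℕ} (n : Fin K → Fin K → ℕ) (P : CyclicPartition K) : ℕ :=
  ∑ i, edgeWeight n P i

/-- The cyclic partition bound `∑ n_kk - w(Π)`. -/
def partitionBound {K : ℕ} (n : Fin K → Fin K → ℕ) (P : CyclicPartition K) : ℤ :=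
  (∑ k, (n k k : ℤ)) - (weight n P : ℤ)

/-- A cyclic partition is optimal if its cyclic partition bound is the tightest one. -/
def IsOptimal {K : ℕ} (n : Fin K → Fin K → ℕ) (P : CyclicPartition K) : Prop :=
  ∀ Q : CyclicPartition K, partitionBound n P ≤ partitionBound n Q

/-- The dominant interference condition: each transmitter that has a cyclic predecessor is
received there strictly stronger than at any other unintended receiver. -/
def IsDominant {K : ℕ} (n : Fin K → Fin K → ℕ) (P : CyclicPartition K) : Prop :=
  ∀ k j : Fin K, P k ≠ k → j ≠ k → j ≠ P k → n j k < n (P k) k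

/-! ### Invertibility -/

/-- The participating inputs `(X_{1,u}, …, X_{K,u})`, in vector form. -/
abbrev ParticipatingInput {K : ℕ} (n : Fin K → Fin K → ℕ) (P : CyclicPartition K) : Type :=
  ∀ i : Fin K, Fin (edgeWeight n P i) → Bool

/-- The number `0.b₁b₂…b_l` in base two. -/
noncomputable def binaryValue {l : ℕ} (b : Fin l → Bool) : ℝ :=
  ∑ r : Fin l, if b r then (1 / 2 : ℝ) ^ ((r : ℕ) + 1) else 0

/-- The participating outputs: `Y_{k,u}` consists of the levels received at Receiver `k` from all
interfering `X_{i,u}`, `i ≠ k`. -/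
noncomputable def participatingOutput {K : ℕ} (n : Fin K → Fin K → ℕ) (P : CyclicPartition K)
    (b : ParticipatingInput n P) : Fin K → ℕ :=
  fun k => xorSum (Finset.univ.filter fun i => i ≠ k)
    (fun i => ⌊(2 : ℝ) ^ n k i * binaryValue (b i)⌋₊)

/-- The sub-channel is invertible under `P`: the participating outputs determine the participating
inputs, i.e. `H(X_u | Y_u) = 0`. -/
def InvertibleUnder {K : ℕ} (n : Fin K → Fin K → ℕ) (P : CyclicPartition K) : Prop :=
  Function.Injective (participatingOutput n P)

/-! ### Power control and treating interference as noise -/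

open Classical in
/-- Entropy in bits of `Z ω`, for `ω` uniformly distributed on a finite type. -/
noncomputable def entropy {Ω β : Type} [Fintype Ω] (Z : Ω → β) : ℝ :=
  ∑ z ∈ Finset.univ.image Z,
    Real.negMulLog (((Finset.univ.filter fun ω => Z ω = z).card : ℝ) / (Fintype.card Ω : ℝ)) /
      Real.log 2

/-- Mutual information in bits of `X ω` and `Y ω`, for `ω` uniformly distributed. -/
noncomputable def mutualInfo {Ω β γ : Type} [Fintype Ω] (X : Ω → β) (Y : Ω → γ) : ℝ :=
  entropy X + entropy Y - entropy (fun ω => (X ω, Y ω))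

/-- The number of input levels that are visible at some receiver. -/
def numLevels {K : ℕ} (n : Fin K → Fin K → ℕ) : ℕ :=
  Finset.univ.sup fun p : Fin K × Fin K => n p.1 p.2

/-- Sample space of the inputs under power control `s`: Transmitter `i` leaves its `s i` most
significant levels empty, and all other visible levels carry independent fair bits. -/
abbrev TINSpace {K : ℕ} (n : Fin K → Fin K → ℕ) (s : Fin K → ℕ) : Type :=
  ∀ i : Fin K, Fin (2 ^ (numLevels n - s i))

/-- The channel input of user `i`; it is below `2 ^ (-s i)`, or zero. -/
noncomputable def tinInput {K : ℕ} (n : Fin K → Fin K → ℕ) (s : Fin K → ℕ)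
    (ω : TINSpace n s) (i : Fin K) : ℝ :=
  ((ω i : ℕ) : ℝ) / (2 : ℝ) ^ numLevels n

/-- The rate `I(X_k; Y_k)` of user `k` over one sub-channel when all transmitters use independent
inputs with power control `s` and Receiver `k` treats all interference as noise. -/
noncomputable def tinRate {K : ℕ} (n : Fin K → Fin K → ℕ) (s : Fin K → ℕ) (k : Fin K) : ℝ :=
  mutualInfo (fun ω : TINSpace n s => tinInput n s ω k)
    (fun ω : TINSpace n s => output n (tinInput n s ω) k)

/-- The rate tuple of separate TIN: over each sub-channel `m`, independently coded, power control
`s m` is used and interference is treated as noise. -/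
noncomputable def separateTINRate {K M : ℕ} (n : Fin M → Fin K → Fin K → ℕ)
    (s : Fin M → Fin K → ℕ) (k : Fin K) : ℝ :=
  ∑ m, tinRate (n m) (s m) k

end ADT

namespace ADT

/-! ### Carry-free addition and truncation -/

section Xor

variable {ι : Type}

/-! Both halves of (b) meet at the sum over the sub-channels of the cyclic partition bounds.
Dominance means that each user in a non-trivial cycle is received in full at its predecessor and
strictly right-shifted at every other unintended receiver. The interference can therefore be
inverted bit by bit from the top (`eq_of_shifted_xorSum_eq`); this gives (a). Converse: let S_k be
the levels of user k heard at some other receiver, and V_k the interference at receiver k. Fano's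
inequality and TIN optimality bound the rate of user k over a block by H(S_k) - H(V_k), plus one bit
for each level of user k not heard elsewhere (`Code.user_bound`). The S_k are independent, and by
inversion all of them are known from the V_k together with the S_i of users in trivial cycles. Hence
the entropies cancel in the sum, leaving exactly the partition bounds (`Code.sum_bound`).
Achievability: the duality theorem for the assignment problem turns a heaviest permutation into
potentials s, t with n_ki ≤ s_i + t_k. Taking s as power control caps the interference at receiver k
at level t_k, so the TIN rates add up to at least the bound (`IsOptimal.exists_powerControl`). These
rates are integers, and uncoded bits attain them without error. -/

theorem xorSum_eq_erase [DecidableEq ι] {s : Finset ι} {i : ι} (hi : i ∈ s) (f : ι → ℕ) :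
    xorSum s f = f i ^^^ xorSum (s.erase i) f := by
  conv_lhs => rw [← Finset.insert_erase hi]
  exact Finset.fold_insert (Finset.notMem_erase i s)

theorem xorSum_congr {s : Finset ι} {f g : ι → ℕ} (h : ∀ i ∈ s, f i = g i) :
    xorSum s f = xorSum s g :=
  Finset.fold_congr h

theorem xorSum_div_two_pow (s : Finset ι) (f : ι → ℕ) (h : ℕ) :
    xorSum s f / 2 ^ h = xorSum s (fun i => f i / 2 ^ h) := by
  classical
  induction s using Finset.induction_on with
  | empty => simp [xorSum]
  | insert a s ha ih =>
    simp only [xorSum, Finset.fold_insert ha] at ih ⊢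
    rw [← ih, ← Nat.shiftRight_eq_div_pow, Nat.shiftRight_xor_distrib]
    simp [Nat.shiftRight_eq_div_pow]

theorem xorSum_lt_two_pow {s : Finset ι} {f : ι → ℕ} {a : ℕ} (h : ∀ i ∈ s, f i < 2 ^ a) :
    xorSum s f < 2 ^ a := by
  classical
  induction s using Finset.induction_on with
  | empty => simp [xorSum]
  | insert b s hb ih =>
    simp only [xorSum, Finset.fold_insert hb] at ih ⊢
    exact Nat.xor_lt_two_pow (h b (Finset.mem_insert_self b s))
      (ih fun i hi => h i (Finset.mem_insert_of_mem hi))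

theorem xor_mod_two_pow_cancel (x d : ℕ) : x = (x / 2 ^ d * 2 ^ d) ^^^ (x % 2 ^ d) := by
  apply Nat.eq_of_testBit_eq
  intro i
  rw [Nat.testBit_xor, Nat.testBit_mod_two_pow, Nat.testBit_mul_two_pow, Nat.testBit_div_two_pow]
  by_cases h : i < d
  · simp [h, Nat.not_le.2 h]
  · have h' : d ≤ i := Nat.not_lt.1 h
    simp [h', Nat.sub_add_cancel h', h]

theorem mul_two_pow_xor_div {u v d : ℕ} (hv : v < 2 ^ d) : ((u * 2 ^ d) ^^^ v) / 2 ^ d = u := by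
  rw [← Nat.shiftRight_eq_div_pow, Nat.shiftRight_xor_distrib]
  simp [Nat.shiftRight_eq_div_pow, Nat.div_eq_of_lt hv]

end Xor

theorem floor_two_pow_mul_div {a b : ℕ} (hab : a ≤ b) (x : ℝ) :
    ⌊(2 : ℝ) ^ b * x⌋₊ / 2 ^ (b - a) = ⌊(2 : ℝ) ^ a * x⌋₊ := by
  have h := Nat.floor_div_natCast ((2 : ℝ) ^ b * x) (2 ^ (b - a))
  rw [← h]
  congr 1
  obtain ⟨c, rfl⟩ := Nat.exists_eq_add_of_le hab
  push_cast
  rw [Nat.add_sub_cancel_left, pow_add]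
  field_simp

theorem floor_two_pow_mul_lt {x : ℝ} (h1 : x < 1) (a : ℕ) :
    ⌊(2 : ℝ) ^ a * x⌋₊ < 2 ^ a := by
  rw [Nat.floor_lt' (by positivity)]
  push_cast
  have : (0 : ℝ) < 2 ^ a := by positivity
  nlinarith

/-! ### Invertibility -/

/-- If every `x i` reaches receiver `P i` in full, and all other receivers after a strict right
shift, then the received sums determine the `x i`, once those of the fixed points are known. -/
theorem eq_of_shifted_xorSum_eq {ι : Type} [Fintype ι] [DecidableEq ι] (P : Equiv.Perm ι)
    (d : ι → ι → ℕ) {x y : ι → ℕ} (hfix : ∀ i, P i = i → x i = y i)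
    (hd0 : ∀ i, P i ≠ i → d (P i) i = 0)
    (hd : ∀ i k, P i ≠ i → k ≠ i → k ≠ P i → 0 < d k i)
    (hxy : ∀ k, xorSum (Finset.univ.filter fun i => i ≠ k) (fun i => x i / 2 ^ d k i) =
      xorSum (Finset.univ.filter fun i => i ≠ k) (fun i => y i / 2 ^ d k i)) : x = y := by
  -- Peel off one bit from the top: at receiver `P i`, every other summand is either known or
  -- shifted by at least one, so down to level `h` it involves only bits already known.
  have step : ∀ h, (∀ i, x i / 2 ^ (h + 1) = y i / 2 ^ (h + 1)) →
      ∀ i, x i / 2 ^ h = y i / 2 ^ h := by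
    intro h ih i
    by_cases hi : P i = i
    · rw [hfix i hi]
    have hmem : i ∈ Finset.univ.filter fun j => j ≠ P i := by
      simpa using fun h : i = P i => hi h.symm
    have e := congrArg (· / 2 ^ h) (hxy (P i))
    simp only [xorSum_div_two_pow] at e
    simp only [xorSum_eq_erase hmem, hd0 i hi, pow_zero, Nat.div_one] at e
    rw [xorSum_congr (g := fun j => y j / 2 ^ d (P i) j / 2 ^ h)] at e
    · exact Nat.xor_left_inj.1 e
    · intro j hj
      simp only [Finset.mem_erase, Finset.mem_filter, Finset.mem_univ, true_and] at hj
      by_cases hj' : P j = j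
      · rw [hfix j hj']
      obtain ⟨c, hc⟩ := Nat.exists_eq_add_of_lt
        (hd j (P i) hj' (fun h => hj.2 h.symm) fun h => hj.1 (P.injective h).symm)
      have e2 := congrArg (· / 2 ^ c) (ih j)
      simp only [Nat.div_div_eq_div_mul, ← pow_add] at e2 ⊢
      rwa [hc, show 0 + c + 1 + h = h + 1 + c by ring]
  have all : ∀ h, ∀ i, x i / 2 ^ h = y i / 2 ^ h := by
    -- All quotients by `2 ^ B` vanish, which starts the downward induction.
    let B := (∑ i, x i) + ∑ i, y i
    have hB : ∀ h, B ≤ h → ∀ i, x i / 2 ^ h = y i / 2 ^ h := by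
      intro h hh i
      have h1 : x i ≤ ∑ i, x i := Finset.single_le_sum (fun _ _ => Nat.zero_le _) (Finset.mem_univ i)
      have h2 : y i ≤ ∑ i, y i := Finset.single_le_sum (fun _ _ => Nat.zero_le _) (Finset.mem_univ i)
      have h3 : h < 2 ^ h := Nat.lt_two_pow_self
      rw [Nat.div_eq_of_lt (by omega), Nat.div_eq_of_lt (by omega)]
    intro h
    by_cases hh : B ≤ h
    · exact hB h hh
    · exact Nat.decreasingInduction (motive := fun k _ => ∀ i, x i / 2 ^ k = y i / 2 ^ k)
        (fun k _ ih => step k ih) (hB B le_rfl) (Nat.le_of_not_le hh)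
  funext i
  simpa using all 0 i

/-- A sum of distinct powers of two, indexed by a set, is the form in which uniqueness of binary
expansions (`Finset.geomSum_injective`) applies. -/
theorem two_pow_mul_binaryValue {l : ℕ} (b : Fin l → Bool) :
    (2 : ℝ) ^ l * binaryValue b =
      ((∑ j ∈ (Finset.univ.filter fun r => b r = true).image (fun r => (r.rev : ℕ)), 2 ^ j : ℕ) : ℝ) := by
  rw [Finset.sum_image (fun r _ r' _ h => Fin.rev_injective (Fin.ext h))]
  rw [binaryValue, ← Finset.sum_filter, Finset.mul_sum]
  push_cast
  refine Finset.sum_congr rfl fun r _ => ?_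
  have h : ((r : ℕ) + 1) + (r.rev : ℕ) = l := by
    rw [Fin.val_rev]
    omega
  have h2 : (2 : ℝ) ^ l = 2 ^ ((r : ℕ) + 1) * 2 ^ (r.rev : ℕ) := by rw [← pow_add, h]
  rw [h2, one_div, inv_pow]
  field_simp

theorem binaryValue_injective_floor {l : ℕ} {b b' : Fin l → Bool}
    (h : ⌊(2 : ℝ) ^ l * binaryValue b⌋₊ = ⌊(2 : ℝ) ^ l * binaryValue b'⌋₊) : b = b' := by
  rw [two_pow_mul_binaryValue, two_pow_mul_binaryValue, Nat.floor_natCast, Nat.floor_natCast] at h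
  have h2 := Finset.geomSum_injective le_rfl h
  have h3 := Finset.image_injective (f := fun r : Fin l => (r.rev : ℕ))
    (fun r r' h => Fin.rev_injective (Fin.ext h)) h2
  funext r
  have h4 := Finset.ext_iff.1 h3 r
  rw [Finset.mem_filter_univ, Finset.mem_filter_univ] at h4
  exact Bool.eq_iff_iff.2 h4

section

variable {K : ℕ} {n : Fin K → Fin K → ℕ} {P : CyclicPartition K}

theorem IsDominant.le_edgeWeight (hdom : IsDominant n P) {i k : Fin K} (hi : P i ≠ i)
    (hk : k ≠ i) : n k i ≤ edgeWeight n P i := by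
  rw [edgeWeight, if_neg hi]
  by_cases h : k = P i
  · rw [h]
  · exact (hdom i k hi hk h).le

theorem IsDominant.invertibleUnder (hdom : IsDominant n P) : InvertibleUnder n P := by
  intro b b' h
  have key : ∀ (b : ParticipatingInput n P) (k i : Fin K), i ≠ k →
      ⌊(2 : ℝ) ^ n k i * binaryValue (b i)⌋₊ =
        ⌊(2 : ℝ) ^ edgeWeight n P i * binaryValue (b i)⌋₊ / 2 ^ (edgeWeight n P i - n k i) := by
    intro b k i hik
    by_cases hi : P i = i
    · have h0 : edgeWeight n P i = 0 := by rw [edgeWeight, if_pos hi]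
      have hz : binaryValue (b i) = 0 :=
        Finset.sum_eq_zero fun r _ => absurd r.isLt (by omega)
      simp [hz]
    · exact (floor_two_pow_mul_div (hdom.le_edgeWeight hi hik.symm) _).symm
  have hx := eq_of_shifted_xorSum_eq P (fun k i => edgeWeight n P i - n k i)
    (x := fun i => ⌊(2 : ℝ) ^ edgeWeight n P i * binaryValue (b i)⌋₊)
    (y := fun i => ⌊(2 : ℝ) ^ edgeWeight n P i * binaryValue (b' i)⌋₊) ?_ ?_ ?_ ?_
  · funext i
    exact binaryValue_injective_floor (congrFun hx i)
  · intro i hi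
    have h0 : edgeWeight n P i = 0 := by rw [edgeWeight, if_pos hi]
    have hz : ∀ b : ParticipatingInput n P, binaryValue (b i) = 0 := fun b =>
      Finset.sum_eq_zero fun r _ => absurd r.isLt (by omega)
    simp [hz]
  · intro i hi
    simp [edgeWeight, hi]
  · intro i k hi hki hk
    have := hdom i k hi hki hk
    simp only [edgeWeight, if_neg hi]
    omega
  · intro k
    have hk := congrFun h k
    simp only [participatingOutput] at hk
    rw [xorSum_congr fun i hi => key b k i (Finset.mem_filter.1 hi).2,
      xorSum_congr fun i hi => key b' k i (Finset.mem_filter.1 hi).2] at hk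
    exact hk

end

/-! ### Entropy of functions on a finite uniform space -/

section Entropy

variable {Ω β γ : Type} [Fintype Ω]

open Classical in
/-- The probability of `Z ω = z`, for `ω` uniformly distributed. -/
noncomputable def prob (Z : Ω → β) (z : β) : ℝ :=
  ((Finset.univ.filter fun ω => Z ω = z).card : ℝ) / (Fintype.card Ω : ℝ)

theorem prob_pos (Z : Ω → β) (ω : Ω) : 0 < prob Z (Z ω) := by
  classical
  have : Nonempty Ω := ⟨ω⟩
  unfold prob
  have : 0 < (Finset.univ.filter fun ω' => Z ω' = Z ω).card :=
    Finset.card_pos.2 ⟨ω, by simp⟩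
  have := Fintype.card_pos (α := Ω)
  positivity

theorem prob_nonneg (Z : Ω → β) (z : β) : 0 ≤ prob Z z := by
  unfold prob
  positivity

open Classical in
theorem sum_comp_eq_sum_prob [Nonempty Ω] (Z : Ω → β) (g : β → ℝ) :
    (∑ ω, g (Z ω)) / (Fintype.card Ω : ℝ) = ∑ z ∈ Finset.univ.image Z, prob Z z * g z := by
  rw [Finset.sum_comp g Z, Finset.sum_div]
  refine Finset.sum_congr rfl fun z _ => ?_
  rw [prob, nsmul_eq_mul]
  ring

open Classical in
theorem sum_prob [Nonempty Ω] (Z : Ω → β) : ∑ z ∈ Finset.univ.image Z, prob Z z = 1 := by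
  have h := sum_comp_eq_sum_prob Z fun _ => 1
  have : (Fintype.card Ω : ℝ) ≠ 0 := Nat.cast_ne_zero.2 Fintype.card_ne_zero
  simpa [this] using h.symm

/-- Averaging over sample points instead of values allows variables with different codomains to be
compared pointwise. -/
theorem entropy_eq [Nonempty Ω] (Z : Ω → β) :
    entropy Z = (∑ ω, -Real.logb 2 (prob Z (Z ω))) / (Fintype.card Ω : ℝ) := by
  classical
  rw [sum_comp_eq_sum_prob Z fun z => -Real.logb 2 (prob Z z), entropy]
  refine Finset.sum_congr rfl fun z _ => ?_
  rw [Real.negMulLog, Real.logb, prob]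
  ring_nf

theorem entropy_le_of_forall_le [Nonempty Ω] {Z : Ω → β} {Z' : Ω → γ}
    (h : ∀ ω, prob Z (Z ω) ≤ prob Z' (Z' ω)) : entropy Z' ≤ entropy Z := by
  rw [entropy_eq, entropy_eq]
  gcongr with ω
  · norm_num
  · exact prob_pos Z ω
  · exact h ω

/-- Gibbs' inequality. -/
theorem entropy_le_cross [Nonempty Ω] (Z : Ω → β) (q : β → ℝ) (hq : ∀ ω, 0 < q (Z ω))
    {s : Finset β} (hs : ∀ ω, Z ω ∈ s) (hq0 : ∀ z ∈ s, 0 ≤ q z) (hs1 : ∑ z ∈ s, q z ≤ 1) :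
    entropy Z ≤ (∑ ω, -Real.logb 2 (q (Z ω))) / (Fintype.card Ω : ℝ) := by
  classical
  have hcard : (0 : ℝ) < Fintype.card Ω := Nat.cast_pos.2 Fintype.card_pos
  rw [entropy_eq, ← sub_nonneg, ← sub_div, ← Finset.sum_sub_distrib]
  -- This is `log x ≤ x - 1` at the likelihood ratio `x = q / prob`.
  have h1 : ∀ ω, (1 - q (Z ω) / prob Z (Z ω)) / Real.log 2 ≤
      -Real.logb 2 (q (Z ω)) - -Real.logb 2 (prob Z (Z ω)) := by
    intro ω
    have hp := prob_pos Z ω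
    have h := Real.log_le_sub_one_of_pos (div_pos (hq ω) hp)
    rw [Real.log_div (hq ω).ne' hp.ne'] at h
    have h2 : (0 : ℝ) < Real.log 2 := Real.log_pos (by norm_num)
    rw [Real.logb, Real.logb, ← neg_div, ← neg_div, ← sub_div]
    exact div_le_div_of_nonneg_right (by linarith) h2.le
  refine le_trans ?_ (div_le_div_of_nonneg_right (Finset.sum_le_sum fun ω _ => h1 ω) hcard.le)
  rw [← Finset.sum_div, div_right_comm]
  refine div_nonneg ?_ (Real.log_nonneg (by norm_num))
  rw [sum_comp_eq_sum_prob Z fun z => 1 - q z / prob Z z]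
  have h2 : ∀ z ∈ Finset.univ.image Z, prob Z z * (1 - q z / prob Z z) = prob Z z - q z := by
    intro z hz
    obtain ⟨ω, -, rfl⟩ := Finset.mem_image.1 hz
    have := (prob_pos Z ω).ne'
    field_simp
  rw [Finset.sum_congr rfl h2, Finset.sum_sub_distrib, sum_prob]
  have h3 : ∑ z ∈ Finset.univ.image Z, q z ≤ ∑ z ∈ s, q z :=
    Finset.sum_le_sum_of_subset_of_nonneg
      (Finset.image_subset_iff.2 fun ω _ => hs ω) fun z hz _ => hq0 z hz
  linarith

theorem entropy_le_of_determines [Nonempty Ω] {Z : Ω → β} {Z' : Ω → γ}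
    (h : ∀ ω ω', Z ω = Z ω' → Z' ω = Z' ω') : entropy Z' ≤ entropy Z := by
  refine entropy_le_of_forall_le fun ω => ?_
  unfold prob
  gcongr
  intro hω
  exact h _ _ hω

/-- Gibbs' inequality against the product of the marginals. -/
theorem entropy_pair_le [Nonempty Ω] (X : Ω → β) (Y : Ω → γ) :
    entropy (fun ω => (X ω, Y ω)) ≤ entropy X + entropy Y := by
  classical
  have h := entropy_le_cross (fun ω => (X ω, Y ω)) (fun z => prob X z.1 * prob Y z.2)
    (fun ω => mul_pos (prob_pos X ω) (prob_pos Y ω))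
    (s := Finset.univ.image X ×ˢ Finset.univ.image Y)
    (fun ω => Finset.mem_product.2 ⟨Finset.mem_image_of_mem _ (Finset.mem_univ _),
      Finset.mem_image_of_mem _ (Finset.mem_univ _)⟩)
    (fun z _ => mul_nonneg (prob_nonneg _ _) (prob_nonneg _ _)) ?_
  · refine h.trans_eq ?_
    rw [entropy_eq, entropy_eq, ← add_div, ← Finset.sum_add_distrib]
    congr 1
    refine Finset.sum_congr rfl fun ω _ => ?_
    rw [Real.logb_mul (prob_pos X ω).ne' (prob_pos Y ω).ne']
    ring
  · rw [Finset.sum_product]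
    simp only [← Finset.mul_sum, sum_prob, mul_one, le_refl]

theorem entropy_pi_le {ι : Type} [Fintype ι] [Nonempty Ω] (X : ι → Ω → β) :
    entropy (fun ω i => X i ω) ≤ ∑ i, entropy (X i) := by
  classical
  have h := entropy_le_cross (fun ω i => X i ω) (fun z => ∏ i, prob (X i) (z i))
    (fun ω => Finset.prod_pos fun i _ => prob_pos (X i) ω)
    (s := Fintype.piFinset fun i => Finset.univ.image (X i))
    (fun ω => Fintype.mem_piFinset.2 fun i => Finset.mem_image_of_mem _ (Finset.mem_univ _))
    (fun z _ => Finset.prod_nonneg fun i _ => prob_nonneg _ _) ?_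
  · refine h.trans_eq ?_
    simp only [entropy_eq]
    rw [← Finset.sum_div, Finset.sum_comm]
    congr 1
    refine Finset.sum_congr rfl fun ω _ => ?_
    rw [Real.logb_prod _ _ fun i _ => (prob_pos (X i) ω).ne', Finset.sum_neg_distrib]
  · rw [← Finset.prod_univ_sum]
    simp only [sum_prob, Finset.prod_const_one, le_refl]

theorem entropy_le_logb_card [Nonempty Ω] (Z : Ω → β) (s : Finset β) (hs : ∀ ω, Z ω ∈ s) :
    entropy Z ≤ Real.logb 2 s.card := by
  have hpos : (0 : ℝ) < s.card :=
    Nat.cast_pos.2 (Finset.card_pos.2 ⟨_, hs (Classical.arbitrary Ω)⟩)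
  refine (entropy_le_cross Z (fun _ => (s.card : ℝ)⁻¹) (fun _ => inv_pos.2 hpos) hs
    (fun _ _ => (inv_pos.2 hpos).le) ?_).trans_eq ?_
  · simp [hpos.ne']
  · have : (Fintype.card Ω : ℝ) ≠ 0 := Nat.cast_ne_zero.2 Fintype.card_ne_zero
    simp [Real.logb_inv, this]

theorem entropy_nonneg [Nonempty Ω] (Z : Ω → β) : 0 ≤ entropy Z := by
  classical
  have h := entropy_le_of_determines (Z := Z) (Z' := fun _ => ()) fun _ _ _ => rfl
  refine le_trans (le_of_eq ?_) h
  rw [entropy_eq]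
  have : (Fintype.card Ω : ℝ) ≠ 0 := Nat.cast_ne_zero.2 Fintype.card_ne_zero
  simp [prob, this]

theorem entropy_of_injective [Nonempty Ω] {Z : Ω → β} (hZ : Function.Injective Z) :
    entropy Z = Real.logb 2 (Fintype.card Ω) := by
  classical
  have : (Fintype.card Ω : ℝ) ≠ 0 := Nat.cast_ne_zero.2 Fintype.card_ne_zero
  have h : ∀ ω, prob Z (Z ω) = (Fintype.card Ω : ℝ)⁻¹ := by
    intro ω
    rw [prob, Finset.card_eq_one.2 ⟨ω, ?_⟩]
    · simp
    · ext ω'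
      simp [hZ.eq_iff]
  rw [entropy_eq]
  simp [h, Real.logb_inv, this]

/-- A form of Fano's inequality: if `W` is recovered from `Y` except on a set of probability `p`,
then `H(W, Y) ≤ H(Y) + 1 + p log |W|`. -/
theorem entropy_pair_le_of_decoder [Nonempty Ω] [Fintype β] (W : Ω → β) (Y : Ω → γ) (g : γ → β)
    {p : ℝ} (hp : open Classical in
      ((Finset.univ.filter fun ω => g (Y ω) ≠ W ω).card : ℝ) / (Fintype.card Ω : ℝ) = p) :
    entropy (fun ω => (W ω, Y ω)) ≤ entropy Y + (1 + p * Real.logb 2 (Fintype.card β)) := by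
  classical
  -- `U` is a correction that reveals `W` only when the decoder errs.
  let U : Ω → Option β := fun ω => if g (Y ω) = W ω then none else some (W ω)
  have h1 : entropy (fun ω => (W ω, Y ω)) ≤ entropy (fun ω => (Y ω, U ω)) := by
    refine entropy_le_of_determines fun ω ω' h => ?_
    obtain ⟨hY, hU⟩ := Prod.ext_iff.1 h
    simp only at hY hU
    simp only [U, hY] at hU
    split_ifs at hU with h1 h2
    · simp [hY, ← h1, ← h2]
    · simp [hY, Option.some.inj hU]
  have hcard : (0 : ℝ) < Fintype.card β :=
    Nat.cast_pos.2 (Fintype.card_pos_iff.2 ⟨W (Classical.arbitrary Ω)⟩)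
  have hΩ : (Fintype.card Ω : ℝ) ≠ 0 := Nat.cast_ne_zero.2 Fintype.card_ne_zero
  -- Under this reference law `none` costs one bit and an error `1 + log |β|` bits, so the binary
  -- entropy function is avoided.
  let q : Option β → ℝ := fun o => o.elim (1 / 2) fun _ => 1 / 2 * (Fintype.card β : ℝ)⁻¹
  have hq : ∀ o, 0 < q o := by
    rintro (_ | _)
    · simp [q]
    · simp only [q, Option.elim]; positivity
  have h2 : entropy U ≤ 1 + p * Real.logb 2 (Fintype.card β) := by
    refine (entropy_le_cross U q (fun ω => hq _) (s := Finset.univ) (by simp)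
      (fun o _ => (hq o).le) ?_).trans_eq ?_
    · rw [Fintype.sum_option]
      simp only [q, Option.elim, Finset.sum_const, Finset.card_univ, nsmul_eq_mul]
      field_simp
      norm_num
    · have h3 : ∀ ω, -Real.logb 2 (q (U ω)) =
          1 + if g (Y ω) ≠ W ω then Real.logb 2 (Fintype.card β) else 0 := by
        intro ω
        by_cases h : g (Y ω) = W ω
        · simp [U, q, h, Real.logb_inv]
        · simp only [U, q, h, if_false, Option.elim, ne_eq, not_false_eq_true, if_true]
          rw [Real.logb_mul (by norm_num) (inv_pos.2 hcard).ne', Real.logb_inv, one_div,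
            Real.logb_inv, Real.logb_self_eq_one (by norm_num)]
          ring
      simp only [h3]
      rw [Finset.sum_add_distrib, ← Finset.sum_filter, Finset.sum_const, Finset.sum_const, ← hp]
      simp only [Finset.card_univ, nsmul_eq_mul, mul_one]
      field_simp
  linarith [entropy_pair_le Y U]

end Entropy

/-! ### Independent coordinates -/

section Independent

variable {ι : Type} [Fintype ι] [DecidableEq ι] {α : ι → Type} [∀ i, Fintype (α i)]
  {β γ : Type}

open Classical in
-- Independence in counting form: exchanging coordinate `k` with a spare copy is a bijection that
-- preserves `q`.
theorem card_filter_coord_mul (k : ι) (p : α k → Prop) (q : (∀ i, α i) → Prop)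
    (hq : ∀ ω a, q (Function.update ω k a) ↔ q ω) :
    (Finset.univ.filter fun ω : ∀ i, α i => p (ω k) ∧ q ω).card * Fintype.card (α k) =
      (Finset.univ.filter p).card * (Finset.univ.filter q).card := by
  rw [← Finset.card_univ (α := α k), ← Finset.card_product, ← Finset.card_product]
  refine Finset.card_bij' (fun x _ => (x.1 k, Function.update x.1 k x.2))
    (fun x _ => (Function.update x.2 k x.1, x.2 k)) ?_ ?_ ?_ ?_
  · intro x hx
    simp only [Finset.mem_product, Finset.mem_filter, Finset.mem_univ, true_and, and_true] at hx ⊢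
    exact ⟨hx.1, (hq _ _).2 hx.2⟩
  · intro x hx
    simp only [Finset.mem_product, Finset.mem_filter, Finset.mem_univ, true_and, and_true,
      Function.update_self] at hx ⊢
    exact ⟨hx.1, (hq _ _).2 hx.2⟩
  · intro x _
    simp
  · intro x _
    simp

variable [∀ i, Nonempty (α i)]

theorem prob_coord (k : ι) (X : α k → β) (x : β) :
    prob (fun ω : ∀ i, α i => X (ω k)) x = prob X x := by
  classical
  have h := card_filter_coord_mul k (fun a => X a = x) (fun _ : ∀ i, α i => True) (by simp)
  have h1 : (Fintype.card (∀ i, α i) : ℝ) ≠ 0 := Nat.cast_ne_zero.2 Fintype.card_ne_zero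
  have h2 : (Fintype.card (α k) : ℝ) ≠ 0 := Nat.cast_ne_zero.2 Fintype.card_ne_zero
  unfold prob
  rw [div_eq_div_iff h1 h2]
  simp only [and_true, Finset.filter_true, Finset.card_univ] at h
  exact_mod_cast h

theorem entropy_coord (k : ι) (X : α k → β) :
    entropy (fun ω : ∀ i, α i => X (ω k)) = entropy X := by
  classical
  have himg : Finset.univ.image (fun ω : ∀ i, α i => X (ω k)) = Finset.univ.image X := by
    ext x
    simp only [Finset.mem_image, Finset.mem_univ, true_and]
    refine ⟨fun ⟨ω, h⟩ => ⟨ω k, h⟩, fun ⟨a, h⟩ => ⟨Function.update (fun i => Classical.arbitrary _) k a, ?_⟩⟩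
    simpa using h
  have hp := fun x => prob_coord (α := α) k X x
  simp only [prob] at hp
  unfold entropy
  convert Finset.sum_congr himg fun x _ => ?_ using 1
  rw [← hp x]

theorem entropy_pair_coord (k : ι) (X : α k → β) (Y : (∀ i, α i) → γ)
    (hY : ∀ ω a, Y (Function.update ω k a) = Y ω) :
    entropy (fun ω : ∀ i, α i => (X (ω k), Y ω)) = entropy X + entropy Y := by
  classical
  rw [← entropy_coord (α := α) k X, entropy_eq, entropy_eq, entropy_eq, ← add_div,
    ← Finset.sum_add_distrib]
  congr 1
  refine Finset.sum_congr rfl fun ω _ => ?_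
  rw [← neg_add, ← Real.logb_mul (prob_pos (fun ω : ∀ i, α i => X (ω k)) ω).ne' (prob_pos Y ω).ne',
    prob_coord]
  congr 2
  have h := card_filter_coord_mul k (fun a => X a = X (ω k)) (fun ω' : ∀ i, α i => Y ω' = Y ω)
    (fun ω' a => by rw [hY])
  have h1 : (Fintype.card (∀ i, α i) : ℝ) ≠ 0 := Nat.cast_ne_zero.2 Fintype.card_ne_zero
  have h2 : (Fintype.card (α k) : ℝ) ≠ 0 := Nat.cast_ne_zero.2 Fintype.card_ne_zero
  unfold prob
  rw [div_mul_div_comm, div_eq_div_iff h1 (mul_ne_zero h2 h1), ← mul_assoc]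
  simp only [Prod.mk.injEq]
  congr 1
  exact_mod_cast h

theorem entropy_pi_coord (X : ∀ i, α i → β) :
    entropy (fun (ω : ∀ i, α i) i => X i (ω i)) = ∑ i, entropy (X i) := by
  classical
  rw [Finset.sum_congr rfl fun i _ => (entropy_coord (α := α) i (X i)).symm]
  simp only [entropy_eq]
  rw [← Finset.sum_div, Finset.sum_comm]
  congr 1
  refine Finset.sum_congr rfl fun ω _ => ?_
  rw [Finset.sum_neg_distrib, ← Real.logb_prod _ _ fun i _ =>
    (prob_pos (fun ω : ∀ i, α i => X i (ω i)) ω).ne']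
  congr 2
  simp only [prob_coord]
  unfold prob
  rw [Finset.prod_div_distrib, Fintype.card_pi]
  push_cast
  congr 1
  rw [← Nat.cast_prod, ← Fintype.card_piFinset]
  congr 2
  ext ω'
  simp [funext_iff]

end Independent

/-! ### Rates of treating interference as noise -/

theorem logb_two_two_pow_cast (a : ℕ) : Real.logb 2 ((2 ^ a : ℕ) : ℝ) = a := by
  push_cast
  rw [Real.logb_pow, Real.logb_self_eq_one (by norm_num), mul_one]

/-- Quotient and remainder recover the `b` uniform bits, and the remainder carries at most `d` of
them. -/
theorem le_entropy_shift (b d : ℕ) :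
    ((b - d : ℕ) : ℝ) ≤ entropy (fun a : Fin (2 ^ b) => (a : ℕ) / 2 ^ d) := by
  rcases Nat.lt_or_ge b d with h | h
  · rw [Nat.sub_eq_zero_of_le h.le, Nat.cast_zero]
    exact entropy_nonneg _
  have h1 := entropy_of_injective (Ω := Fin (2 ^ b)) Function.injective_id
  rw [Fintype.card_fin, logb_two_two_pow_cast] at h1
  have h2 : entropy (id : Fin (2 ^ b) → Fin (2 ^ b)) ≤
      entropy (fun a : Fin (2 ^ b) => ((a : ℕ) / 2 ^ d, (a : ℕ) % 2 ^ d)) := by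
    refine entropy_le_of_determines fun a a' h => ?_
    obtain ⟨h3, h4⟩ := Prod.ext_iff.1 h
    simp only at h3 h4
    refine Fin.ext ?_
    simp only [id]
    rw [← Nat.div_add_mod (a : ℕ) (2 ^ d), h3, h4, Nat.div_add_mod]
  have h3 := entropy_pair_le (fun a : Fin (2 ^ b) => (a : ℕ) / 2 ^ d)
    (fun a : Fin (2 ^ b) => (a : ℕ) % 2 ^ d)
  have h4 := entropy_le_logb_card (fun a : Fin (2 ^ b) => (a : ℕ) % 2 ^ d) (Finset.range (2 ^ d))
    (fun a => Finset.mem_range.2 (Nat.mod_lt _ (by positivity)))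
  rw [Finset.card_range, logb_two_two_pow_cast] at h4
  push_cast [h]
  linarith

theorem div_two_pow_lt {a b d : ℕ} (h : a < 2 ^ b) : a / 2 ^ d < 2 ^ (b - d) := by
  rw [Nat.div_lt_iff_lt_mul (by positivity), ← pow_add]
  exact h.trans_le (Nat.pow_le_pow_right (by norm_num) (by omega))

/-- A carry-free sum of independent uniform inputs is as random as its strongest summand. -/
theorem entropy_xorSum {ι : Type} [Fintype ι] [DecidableEq ι] (b d : ι → ℕ) (S : Finset ι) :
    entropy (fun ω : ∀ i, Fin (2 ^ b i) => xorSum S fun i => (ω i : ℕ) / 2 ^ d i) =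
      ((S.sup fun i => b i - d i : ℕ) : ℝ) := by
  apply le_antisymm
  · have h := entropy_le_logb_card
      (fun ω : ∀ i, Fin (2 ^ b i) => xorSum S fun i => (ω i : ℕ) / 2 ^ d i)
      (Finset.range (2 ^ S.sup fun i => b i - d i)) (fun ω => Finset.mem_range.2 <|
        xorSum_lt_two_pow fun i hi => (div_two_pow_lt (ω i).isLt).trans_le <|
          Nat.pow_le_pow_right (by norm_num) (Finset.le_sup (f := fun i => b i - d i) hi))
    rwa [Finset.card_range, logb_two_two_pow_cast] at h
  · rcases S.eq_empty_or_nonempty with rfl | hS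
    · simpa using entropy_nonneg _
    obtain ⟨j, hj, hsup⟩ := Finset.exists_mem_eq_sup S hS fun i => b i - d i
    rw [hsup]
    -- `V` is independent of the strongest summand, and the full sum together with `V` reveals that
    -- summand.
    let V : (∀ i, Fin (2 ^ b i)) → ℕ := fun ω => xorSum (S.erase j) fun i => (ω i : ℕ) / 2 ^ d i
    have h1 := entropy_pair_coord (α := fun i => Fin (2 ^ b i)) j (fun a => (a : ℕ) / 2 ^ d j) V
      (fun ω a => xorSum_congr fun i hi => by
        rw [Function.update_of_ne (Finset.ne_of_mem_erase hi)])
    have h2 := le_entropy_shift (b j) (d j)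
    have h3 : entropy (fun ω : ∀ i, Fin (2 ^ b i) => ((ω j : ℕ) / 2 ^ d j, V ω)) ≤
        entropy (fun ω : ∀ i, Fin (2 ^ b i) => (xorSum S fun i => (ω i : ℕ) / 2 ^ d i, V ω)) := by
      refine entropy_le_of_determines fun ω ω' h => ?_
      obtain ⟨h3, h4⟩ := Prod.ext_iff.1 h
      simp only [xorSum_eq_erase hj] at h3 h4
      refine Prod.ext ?_ h4
      change _ ^^^ V ω = _ ^^^ V ω' at h3
      rw [h4] at h3
      exact Nat.xor_left_inj.1 h3
    have h4 := entropy_pair_le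
      (fun ω : ∀ i, Fin (2 ^ b i) => xorSum S fun i => (ω i : ℕ) / 2 ^ d i) V
    linarith

section TIN

variable {K : ℕ} (n : Fin K → Fin K → ℕ) (s : Fin K → ℕ)

/-- The part of the output of receiver `k` that is caused by the other users. -/
noncomputable def interference (x : Fin K → ℝ) (k : Fin K) : ℕ :=
  xorSum (Finset.univ.filter fun i => i ≠ k) fun i => ⌊(2 : ℝ) ^ n k i * x i⌋₊

theorem output_eq (x : Fin K → ℝ) (k : Fin K) :
    output n x k = ⌊(2 : ℝ) ^ n k k * x k⌋₊ ^^^ interference n x k := by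
  rw [output, xorSum_eq_erase (Finset.mem_univ k), interference, Finset.filter_ne']

/-- The number of levels of receiver `k` that are subject to interference. -/
def interferenceLevel (k : Fin K) : ℕ :=
  (Finset.univ.filter fun i => i ≠ k).sup fun i => n k i - s i

/-- The number of levels of user `k` that are received above the interference. -/
def tinBits (k : Fin K) : ℕ :=
  n k k - s k - interferenceLevel n s k

theorem le_numLevels (k i : Fin K) : n k i ≤ numLevels n :=
  Finset.le_sup (f := fun p : Fin K × Fin K => n p.1 p.2) (Finset.mem_univ (k, i))

theorem floor_tinInput (ω : TINSpace n s) (k i : Fin K) :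
    ⌊(2 : ℝ) ^ n k i * tinInput n s ω i⌋₊ = (ω i : ℕ) / 2 ^ (numLevels n - n k i) := by
  rw [← floor_two_pow_mul_div (le_numLevels n k i), tinInput, mul_div_cancel₀ _ (by positivity),
    Nat.floor_natCast]

theorem sub_sub_numLevels_sub (k i : Fin K) :
    numLevels n - s i - (numLevels n - n k i) = n k i - s i := by
  have := le_numLevels n k i
  omega

/-- Given the input of user `k`, output and interference determine each other, so the rate is H(Y) -
H(V), a difference of two level counts. -/
theorem tinRate_eq (k : Fin K) : tinRate n s k = tinBits n s k := by
  have hY : entropy (fun ω : TINSpace n s => output n (tinInput n s ω) k) =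
      ((Finset.univ.sup fun i => n k i - s i : ℕ) : ℝ) := by
    have h := entropy_xorSum (fun i => numLevels n - s i) (fun i => numLevels n - n k i) Finset.univ
    simp only [sub_sub_numLevels_sub] at h
    rw [← h]
    simp only [output, floor_tinInput]
  have hV : entropy (fun ω : TINSpace n s => interference n (tinInput n s ω) k) =
      (interferenceLevel n s k : ℝ) := by
    have h := entropy_xorSum (fun i => numLevels n - s i) (fun i => numLevels n - n k i)
      (Finset.univ.filter fun i => i ≠ k)
    simp only [sub_sub_numLevels_sub] at h
    rw [interferenceLevel, ← h]
    simp only [interference, floor_tinInput]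
  have hXV := entropy_pair_coord (α := fun i => Fin (2 ^ (numLevels n - s i))) k
    (fun a => ((a : ℕ) : ℝ) / (2 : ℝ) ^ numLevels n)
    (fun ω : TINSpace n s => interference n (tinInput n s ω) k)
    (fun ω a => xorSum_congr fun i hi => by
      rw [tinInput, tinInput, Function.update_of_ne (Finset.mem_filter.1 hi).2])
  rw [← entropy_coord (α := fun i => Fin (2 ^ (numLevels n - s i))) k] at hXV
  change entropy (fun ω : TINSpace n s =>
    (tinInput n s ω k, interference n (tinInput n s ω) k)) =
      entropy (fun ω : TINSpace n s => tinInput n s ω k) + _ at hXV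
  have hXY : entropy (fun ω : TINSpace n s => (tinInput n s ω k, output n (tinInput n s ω) k)) =
      entropy (fun ω : TINSpace n s => (tinInput n s ω k, interference n (tinInput n s ω) k)) := by
    apply le_antisymm <;> refine entropy_le_of_determines fun ω ω' h => ?_ <;>
      obtain ⟨h1, h2⟩ := Prod.ext_iff.1 h <;> refine Prod.ext h1 ?_ <;>
      simp only [output_eq] at h1 h2 ⊢
    · rw [h1, h2]
    · rw [h1] at h2
      exact Nat.xor_right_inj.1 h2
  rw [tinRate, mutualInfo, hXY, hXV, hY, hV]
  have hsup : (Finset.univ.sup fun i => n k i - s i) =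
      tinBits n s k + interferenceLevel n s k := by
    rw [← Finset.insert_erase (Finset.mem_univ k), Finset.sup_insert, ← Finset.filter_ne']
    change max (n k k - s k) (interferenceLevel n s k) = _
    rw [tinBits]
    omega
  rw [hsup]
  push_cast
  ring

/-- The lowest bit of `u k` lands directly above the interference, so division strips the
interference off. -/
theorem tinBits_decode {u : Fin K → ℕ} (hlt : ∀ i, u i < 2 ^ tinBits n s i) (k : Fin K) :
    output n (fun i => (u i : ℝ) / (2 : ℝ) ^ (s i + tinBits n s i)) k /
      2 ^ interferenceLevel n s k % 2 ^ tinBits n s k = u k := by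
  have hu := hlt k
  rcases Nat.eq_zero_or_pos (tinBits n s k) with h0 | hpos
  · rw [h0] at hu ⊢
    omega
  have hV : interference n (fun i => (u i : ℝ) / (2 : ℝ) ^ (s i + tinBits n s i)) k <
      2 ^ interferenceLevel n s k := by
    refine xorSum_lt_two_pow fun i hi => ?_
    have hle : n k i - s i ≤ interferenceLevel n s k :=
      Finset.le_sup (f := fun i => n k i - s i) hi
    rw [Nat.floor_lt' (by positivity)]
    push_cast
    have hui : (u i : ℝ) < 2 ^ tinBits n s i := by exact_mod_cast hlt i
    rw [mul_div_assoc', div_lt_iff₀ (by positivity), ← pow_add]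
    calc (2 : ℝ) ^ n k i * (u i : ℝ) < 2 ^ n k i * 2 ^ tinBits n s i := by gcongr
      _ = 2 ^ (n k i + tinBits n s i) := by rw [pow_add]
      _ ≤ _ := pow_le_pow_right₀ (by norm_num) (by omega)
  have hfloor : ⌊(2 : ℝ) ^ n k k * ((u k : ℝ) / (2 : ℝ) ^ (s k + tinBits n s k))⌋₊ =
      u k * 2 ^ interferenceLevel n s k := by
    -- Positivity of `tinBits` ensures that neither natural subtraction truncates.
    have hn : n k k = s k + tinBits n s k + interferenceLevel n s k := by
      rw [tinBits] at hpos ⊢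
      omega
    have h2 : (2 : ℝ) ^ n k k * ((u k : ℝ) / (2 : ℝ) ^ (s k + tinBits n s k)) =
        ((u k * 2 ^ interferenceLevel n s k : ℕ) : ℝ) := by
      rw [hn, pow_add (2 : ℝ) (s k + tinBits n s k)]
      push_cast
      field_simp
    rw [h2, Nat.floor_natCast]
  rw [output_eq, hfloor, mul_two_pow_xor_div hV, Nat.mod_eq_of_lt hu]

end TIN

/-! ### Zero-error achievability of the TIN rates -/

theorem numMessages_natCast (N r : ℕ) : numMessages N (r : ℝ) = 2 ^ (N * r) := by
  rw [numMessages, ← Nat.cast_mul, Real.rpow_natCast]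
  exact_mod_cast Nat.ceil_natCast (R := ℝ) (2 ^ (N * r))

theorem separateTINRate_eq {K M : ℕ} (n : Fin M → Fin K → Fin K → ℕ) (s : Fin M → Fin K → ℕ)
    (k : Fin K) : separateTINRate n s k = ((∑ m, tinBits (n m) (s m) k : ℕ) : ℝ) := by
  simp only [separateTINRate, tinRate_eq, Nat.cast_sum]

/-- Sending uncoded bits on the levels above the interference achieves the rates of separate
TIN without errors. -/
theorem achievable_separateTINRate {K M : ℕ} (n : Fin M → Fin K → Fin K → ℕ)
    (s : Fin M → Fin K → ℕ) : Achievable n (separateTINRate n s) := by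
  refine ⟨fun k => by rw [separateTINRate_eq]; positivity, ?_⟩
  have hcard : ∀ (N : ℕ) (i : Fin K), Fintype.card (Fin (numMessages N (separateTINRate n s i))) =
      Fintype.card (Fin N → ∀ m, Fin (2 ^ tinBits (n m) (s m) i)) := by
    intro N i
    simp [separateTINRate_eq, numMessages_natCast, -Nat.cast_sum, Finset.prod_pow_eq_pow_sum,
      ← pow_mul, mul_comm]
  let e := fun N i => Fintype.equivOfCardEq (hcard N i)
  let c : ∀ N : ℕ, Code K M N (fun i => numMessages N (separateTINRate n s i)) := fun N =>
    { enc := fun i w t m =>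
        ⟨((e N i w t m : ℕ) : ℝ) / (2 : ℝ) ^ (s m i + tinBits (n m) (s m) i), by
          have h : ((e N i w t m : ℕ) : ℝ) < 2 ^ tinBits (n m) (s m) i := by
            exact_mod_cast (e N i w t m).isLt
          refine ⟨by positivity, ?_⟩
          rw [div_lt_one (by positivity)]
          exact h.trans_le (pow_le_pow_right₀ (by norm_num) (by omega))⟩
      dec := fun k y => (e N k).symm fun t m =>
        ⟨y t m / 2 ^ interferenceLevel (n m) (s m) k % 2 ^ tinBits (n m) (s m) k,
          Nat.mod_lt _ (by positivity)⟩ }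
  refine ⟨c, fun k => ?_⟩
  have hzero : ∀ N, (c N).errorProb n k = 0 := by
    intro N
    rw [Code.errorProb, Finset.filter_false_of_mem, Finset.card_empty, Nat.cast_zero, zero_div]
    intro w _
    rw [not_not, Equiv.symm_apply_eq]
    funext t m
    exact Fin.ext (tinBits_decode (n m) (s m) (fun i => (e N i (w i) t m).isLt) k)
  simp only [hzero, tendsto_const_nhds]

/-! ### The upper bound on the sum rate -/

theorem entropy_block_le {Ω : Type} [Fintype Ω] [Nonempty Ω] {M N : ℕ}
    (Z : Ω → Fin N → Fin M → ℕ) (a : Fin M → ℕ) (h : ∀ ω t m, Z ω t m < 2 ^ a m) :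
    entropy Z ≤ ((N * ∑ m, a m : ℕ) : ℝ) := by
  have h1 := entropy_le_logb_card Z
    (Fintype.piFinset fun _ => Fintype.piFinset fun m => Finset.range (2 ^ a m))
    (fun ω => by simpa using h ω)
  refine h1.trans_eq ?_
  rw [← logb_two_two_pow_cast (N * _)]
  congr 2
  simp only [Fintype.card_piFinset, Finset.card_range, Finset.prod_pow_eq_pow_sum,
    Finset.sum_const, Finset.card_univ, Fintype.card_fin, smul_eq_mul]

section

variable {K : ℕ} {n : Fin K → Fin K → ℕ} {P : CyclicPartition K}

/-- The number of levels of user `i` that are heard at some other receiver. -/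
def heardLevel (n : Fin K → Fin K → ℕ) (i : Fin K) : ℕ :=
  (Finset.univ.filter fun j => j ≠ i).sup fun j => n j i

theorem le_heardLevel (n : Fin K → Fin K → ℕ) {i k : Fin K} (h : i ≠ k) :
    n k i ≤ heardLevel n i :=
  Finset.le_sup (f := fun j => n j i) (by simpa using h.symm)

theorem IsDominant.heardLevel_eq (hdom : IsDominant n P) {i : Fin K} (hi : P i ≠ i) :
    heardLevel n i = n (P i) i := by
  refine le_antisymm (Finset.sup_le fun k hk => ?_) (le_heardLevel n hi.symm)
  have := hdom.le_edgeWeight hi (Finset.mem_filter.1 hk).2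
  rwa [edgeWeight, if_neg hi] at this

theorem edgeWeight_le_heardLevel (i : Fin K) : edgeWeight n P i ≤ heardLevel n i := by
  rw [edgeWeight]
  split_ifs with hi
  · exact Nat.zero_le _
  · exact le_heardLevel n (Ne.symm hi)

theorem TINOptimal.heardLevel_le (h : TINOptimal n) (k : Fin K) : heardLevel n k ≤ n k k :=
  Finset.sup_le fun j hj =>
    (Nat.le_add_right _ _).trans (h k j j (Finset.mem_filter.1 hj).2 (Finset.mem_filter.1 hj).2)

/-- TIN optimality says exactly that the interference stays below the levels of user `k` that are
heard elsewhere. -/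
theorem TINOptimal.interference_lt (h : TINOptimal n) {x : Fin K → ℝ} (hx : ∀ i, x i < 1)
    (k : Fin K) : interference n x k < 2 ^ (n k k - heardLevel n k) := by
  refine xorSum_lt_two_pow fun i hi => (floor_two_pow_mul_lt (hx i) _).trans_le ?_
  refine Nat.pow_le_pow_right (by norm_num) ?_
  have hi' := (Finset.mem_filter.1 hi).2
  have h0 := h k i i hi' hi'
  have h1 : heardLevel n k ≤ n k k - n k i := Finset.sup_le fun j hj => by
    have := h k j i (Finset.mem_filter.1 hj).2 hi'
    omega
  have := h.heardLevel_le k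
  omega

/-- The levels of user `i` that are heard at some other receiver, as a number. -/
noncomputable def heard (n : Fin K → Fin K → ℕ) (i : Fin K) (x : ℝ) : ℕ :=
  ⌊(2 : ℝ) ^ heardLevel n i * x⌋₊

/-- The part of an output that remains once the levels of the desired user heard elsewhere are
subtracted. -/
noncomputable def residue (n : Fin K → Fin K → ℕ) (x : Fin K → ℝ) (k : Fin K) : ℕ :=
  (⌊(2 : ℝ) ^ n k k * x k⌋₊ % 2 ^ (n k k - heardLevel n k)) ^^^ interference n x k

theorem TINOptimal.residue_lt (h : TINOptimal n) {x : Fin K → ℝ} (hx : ∀ i, x i < 1)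
    (k : Fin K) : residue n x k < 2 ^ (n k k - heardLevel n k) :=
  Nat.xor_lt_two_pow (Nat.mod_lt _ (by positivity)) (h.interference_lt hx k)

theorem TINOptimal.output_eq_heard_xor_residue (h : TINOptimal n) (x : Fin K → ℝ) (k : Fin K) :
    output n x k =
      (heard n k (x k) * 2 ^ (n k k - heardLevel n k)) ^^^ residue n x k := by
  rw [output_eq, residue, ← Nat.xor_assoc, heard, ← floor_two_pow_mul_div (h.heardLevel_le k),
    ← xor_mod_two_pow_cancel]

theorem interference_eq_heard (n : Fin K → Fin K → ℕ) (x : Fin K → ℝ) (k : Fin K) :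
    interference n x k = xorSum (Finset.univ.filter fun i => i ≠ k)
      fun i => heard n i (x i) / 2 ^ (heardLevel n i - n k i) :=
  xorSum_congr fun i hi =>
    (floor_two_pow_mul_div (le_heardLevel n (Finset.mem_filter.1 hi).2) (x i)).symm

/-- Under dominance the interference determines all heard levels, once those of the users in
trivial cycles are known. -/
theorem IsDominant.heard_eq (hdom : IsDominant n P) {x y : Fin K → ℝ}
    (hfix : ∀ i, P i = i → heard n i (x i) = heard n i (y i))
    (hxy : ∀ k, interference n x k = interference n y k) (i : Fin K) :
    heard n i (x i) = heard n i (y i) := by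
  refine congrFun (eq_of_shifted_xorSum_eq P (fun k i => heardLevel n i - n k i)
    (x := fun i => heard n i (x i)) (y := fun i => heard n i (y i)) hfix ?_ ?_ ?_) i
  · intro i hi
    simp [hdom.heardLevel_eq hi]
  · intro i k hi hki hk
    rw [hdom.heardLevel_eq hi]
    exact Nat.sub_pos_of_lt (hdom i k hi hki hk)
  · intro k
    rw [← interference_eq_heard, ← interference_eq_heard, hxy]

end

/-! ### Converse for a fixed code -/

namespace Code

variable {K M N : ℕ} {W : Fin K → ℕ} (n : Fin M → Fin K → Fin K → ℕ) (c : Code K M N W)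

/-- The transmitted symbols in channel use `t` of sub-channel `m`. -/
def sent (w : ∀ i, Fin (W i)) (t : Fin N) (m : Fin M) (i : Fin K) : ℝ := c.enc i (w i) t m

/-- The block of levels of user `k` that are heard at other receivers. -/
noncomputable def heardBlock (k : Fin K) (a : Fin (W k)) : Fin N → Fin M → ℕ :=
  fun t m => heard (n m) k (c.enc k a t m)

/-- The block of interference at receiver `k`. -/
noncomputable def interferenceBlock (k : Fin K) (w : ∀ i, Fin (W i)) : Fin N → Fin M → ℕ :=
  fun t m => interference (n m) (c.sent w t m) k

theorem sent_lt_one (w : ∀ i, Fin (W i)) (t : Fin N) (m : Fin M) (i : Fin K) :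
    c.sent w t m i < 1 :=
  (c.enc i (w i) t m).2.2

variable {n}

/-- Three estimates combine: H(W, Y) is at least log |W| + H(V), since the message and the output
reveal the independent interference; Fano bounds H(W, Y) above through H(Y); and Y is a function of
the heard block and a residue confined to the unheard levels. -/
theorem user_bound (hTIN : ∀ m, TINOptimal (n m)) [∀ i, Nonempty (Fin (W i))] (k : Fin K) :
    (1 - c.errorProb n k) * Real.logb 2 (W k) ≤
      entropy (c.heardBlock n k) - entropy (c.interferenceBlock n k) +
        ((N * ∑ m, (n m k k - heardLevel (n m) k) : ℕ) : ℝ) + 1 := by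
  let Y : (∀ i, Fin (W i)) → Fin N → Fin M → ℕ := fun w => c.received n w k
  have hYm : ∀ w t m, Y w t m = output (n m) (c.sent w t m) k := fun _ _ _ => rfl
  have hfano := entropy_pair_le_of_decoder (fun w : ∀ i, Fin (W i) => w k) Y (c.dec k)
    (p := c.errorProb n k) (by rw [errorProb]; congr!)
  rw [Fintype.card_fin] at hfano
  have hindep := entropy_pair_coord (α := fun i => Fin (W i)) k id (c.interferenceBlock n k)
    (fun w a => by
      funext t m
      rw [interferenceBlock, interferenceBlock, interference, interference]
      refine xorSum_congr fun i hi => ?_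
      rw [sent, sent, Function.update_of_ne (Finset.mem_filter.1 hi).2])
  rw [entropy_of_injective Function.injective_id, Fintype.card_fin] at hindep
  have h1 : entropy (fun w : ∀ i, Fin (W i) => (id (w k), c.interferenceBlock n k w)) ≤
      entropy (fun w : ∀ i, Fin (W i) => (w k, Y w)) := by
    refine entropy_le_of_determines fun w w' h => ?_
    obtain ⟨hw, hY⟩ := Prod.ext_iff.1 h
    simp only at hw hY
    refine Prod.ext hw ?_
    funext t m
    have h2 := congrFun (congrFun hY t) m
    rw [hYm, hYm, output_eq, output_eq, sent, sent, hw] at h2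
    exact Nat.xor_right_inj.1 h2
  let Z : (∀ i, Fin (W i)) → Fin N → Fin M → ℕ := fun w t m => residue (n m) (c.sent w t m) k
  have h2 : entropy Y ≤ entropy (fun w : ∀ i, Fin (W i) => (c.heardBlock n k (w k), Z w)) := by
    refine entropy_le_of_determines fun w w' h => ?_
    obtain ⟨hS, hZ⟩ := Prod.ext_iff.1 h
    funext t m
    rw [hYm, hYm, (hTIN m).output_eq_heard_xor_residue, (hTIN m).output_eq_heard_xor_residue]
    have h3 := congrFun (congrFun hS t) m
    have h4 := congrFun (congrFun hZ t) m
    simp only [heardBlock] at h3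
    simp only [Z] at h4
    rw [h4]
    simp only [sent, h3]
  have h3 := entropy_pair_le (fun w : ∀ i, Fin (W i) => c.heardBlock n k (w k)) Z
  rw [entropy_coord (α := fun i => Fin (W i)) k (c.heardBlock n k)] at h3
  have h4 := entropy_block_le Z (fun m => n m k k - heardLevel (n m) k)
    (fun w t m => (hTIN m).residue_lt (c.sent_lt_one w t m) k)
  linarith

theorem sum_entropy_heardBlock_le {P : Fin M → CyclicPartition K}
    (hdom : ∀ m, IsDominant (n m) (P m)) [∀ i, Nonempty (Fin (W i))] :
    ∑ k, entropy (c.heardBlock n k) ≤ ∑ k, (entropy (c.interferenceBlock n k) +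
      ((N * ∑ m, (heardLevel (n m) k - edgeWeight (n m) (P m) k) : ℕ) : ℝ)) := by
  -- Side information: the heard levels of users in trivial cycles, which inversion does not
  -- recover. Which users these are may vary with `m`.
  let T : Fin K → (∀ i, Fin (W i)) → Fin N → Fin M → ℕ := fun i w t m =>
    if P m i = i then c.heardBlock n i (w i) t m else 0
  have h1 := entropy_pi_coord (α := fun i => Fin (W i)) (c.heardBlock n)
  have h2 : entropy (fun (w : ∀ i, Fin (W i)) i => c.heardBlock n i (w i)) ≤
      entropy (fun w : ∀ i, Fin (W i) =>
        (fun k => c.interferenceBlock n k w, fun k => T k w)) := by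
    refine entropy_le_of_determines fun w w' h => ?_
    obtain ⟨hV, hT⟩ := Prod.ext_iff.1 h
    funext i t m
    refine (hdom m).heard_eq (x := c.sent w t m) (y := c.sent w' t m) (fun j hj => ?_)
      (fun k => congrFun (congrFun (congrFun hV k) t) m) i
    have h3 := congrFun (congrFun (congrFun hT j) t) m
    simp only [T, if_pos hj] at h3
    exact h3
  have h3 := entropy_pair_le (fun (w : ∀ i, Fin (W i)) k => c.interferenceBlock n k w)
    (fun w k => T k w)
  have h4 := entropy_pi_le (c.interferenceBlock n)
  have h5 := entropy_pi_le T
  have h6 : ∑ k, entropy (T k) ≤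
      ∑ k, ((N * ∑ m, (heardLevel (n m) k - edgeWeight (n m) (P m) k) : ℕ) : ℝ) := by
    refine Finset.sum_le_sum fun k _ => entropy_block_le _ _ fun w t m => ?_
    simp only [T]
    split_ifs with hk
    · rw [edgeWeight, if_pos hk]
      exact floor_two_pow_mul_lt (c.enc k (w k) t m).2.2 _
    · positivity
  rw [Finset.sum_add_distrib]
  linarith

theorem sum_bound (hTIN : ∀ m, TINOptimal (n m)) {P : Fin M → CyclicPartition K}
    (hdom : ∀ m, IsDominant (n m) (P m)) [∀ i, Nonempty (Fin (W i))] :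
    ∑ k, (1 - c.errorProb n k) * Real.logb 2 (W k) ≤
      K + N * ((∑ m, partitionBound (n m) (P m) : ℤ) : ℝ) := by
  have h1 := Finset.sum_le_sum fun k (_ : k ∈ Finset.univ) => c.user_bound hTIN k
  have h2 := c.sum_entropy_heardBlock_le hdom
  simp only [Finset.sum_add_distrib, Finset.sum_sub_distrib, Finset.sum_const, Finset.card_univ,
    Fintype.card_fin, nsmul_eq_mul, mul_one] at h1 h2
  have h3 : ∑ k, ((N * ∑ m, (n m k k - heardLevel (n m) k) : ℕ) : ℝ) +
      ∑ k, ((N * ∑ m, (heardLevel (n m) k - edgeWeight (n m) (P m) k) : ℕ) : ℝ) =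
        N * ((∑ m, partitionBound (n m) (P m) : ℤ) : ℝ) := by
    -- The heard levels cancel user by user, leaving `n_kk` minus the edge weight.
    have h4 : ∀ m, ((partitionBound (n m) (P m) : ℤ) : ℝ) =
        ∑ k, (((n m k k - heardLevel (n m) k : ℕ) : ℝ) +
          ((heardLevel (n m) k - edgeWeight (n m) (P m) k : ℕ) : ℝ)) := by
      intro m
      rw [partitionBound, weight]
      push_cast
      rw [← Finset.sum_sub_distrib]
      refine Finset.sum_congr rfl fun k _ => ?_
      rw [Nat.cast_sub ((hTIN m).heardLevel_le k), Nat.cast_sub (edgeWeight_le_heardLevel k)]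
      ring
    rw [Int.cast_sum]
    simp only [h4]
    rw [Finset.sum_comm]
    simp only [Nat.cast_mul, Nat.cast_sum, ← Finset.mul_sum, Finset.sum_add_distrib, ← mul_add]
  linarith

theorem errorProb_le_one [∀ i, Nonempty (Fin (W i))] (k : Fin K) : c.errorProb n k ≤ 1 := by
  rw [errorProb, div_le_one (Nat.cast_pos.2 Fintype.card_pos)]
  exact_mod_cast Finset.card_le_univ _

end Code

/-! ### Large block lengths and the closure -/

theorem le_logb_numMessages (N : ℕ) (R : ℝ) : N * R ≤ Real.logb 2 (numMessages N R) := by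
  have h : (0 : ℝ) < (2 : ℝ) ^ ((N : ℝ) * R) := Real.rpow_pos_of_pos (by norm_num) _
  have h1 : (2 : ℝ) ^ ((N : ℝ) * R) ≤ numMessages N R := Nat.le_ceil _
  rwa [Real.le_logb_iff_rpow_le (by norm_num) (h.trans_le h1)]

theorem numMessages_pos (N : ℕ) (R : ℝ) : 0 < numMessages N R :=
  Nat.ceil_pos.2 (Real.rpow_pos_of_pos (by norm_num) _)

variable {K M : ℕ} {n : Fin M → Fin K → Fin K → ℕ}

/-- After division by `N`, the slack `K / N` and the error probabilities both vanish in the limit.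
-/
theorem Achievable.sum_le (hTIN : ∀ m, TINOptimal (n m)) {P : Fin M → CyclicPartition K}
    (hdom : ∀ m, IsDominant (n m) (P m)) {R : Fin K → ℝ} (hR : Achievable n R) :
    ∑ k, R k ≤ ((∑ m, partitionBound (n m) (P m) : ℤ) : ℝ) := by
  obtain ⟨hR0, c, hc⟩ := hR
  set C : ℝ := ((∑ m, partitionBound (n m) (P m) : ℤ) : ℝ)
  have h1 : Filter.Tendsto (fun N : ℕ => ∑ k, (1 - (c N).errorProb n k) * R k) Filter.atTop
      (nhds (∑ k, (1 - 0) * R k)) :=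
    tendsto_finsetSum _ fun k _ => (tendsto_const_nhds.sub (hc k)).mul_const _
  have h2 : Filter.Tendsto (fun N : ℕ => (K : ℝ) / (N : ℝ) + C) Filter.atTop (nhds (0 + C)) :=
    (tendsto_const_div_atTop_nhds_zero_nat (K : ℝ)).add_const C
  simp only [sub_zero, one_mul] at h1
  rw [zero_add] at h2
  refine le_of_tendsto_of_tendsto h1 h2 ?_
  filter_upwards [Filter.eventually_gt_atTop 0] with N hN
  have : ∀ i, Nonempty (Fin (numMessages N (R i))) := fun i => ⟨⟨0, numMessages_pos N (R i)⟩⟩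
  have hN' : (0 : ℝ) < N := Nat.cast_pos.2 hN
  have h3 := (c N).sum_bound hTIN hdom
  have h4 : ∑ k, (1 - (c N).errorProb n k) * (N * R k) ≤ K + N * C := by
    refine le_trans (Finset.sum_le_sum fun k _ => ?_) h3
    exact mul_le_mul_of_nonneg_left (le_logb_numMessages N (R k))
      (sub_nonneg.2 ((c N).errorProb_le_one k))
  have h5 : ∑ k, (1 - (c N).errorProb n k) * (N * R k) =
      N * ∑ k, (1 - (c N).errorProb n k) * R k := by
    rw [Finset.mul_sum]
    exact Finset.sum_congr rfl fun k _ => by ring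
  rw [h5] at h4
  rw [← sub_nonneg] at h4 ⊢
  have h6 : (K : ℝ) / N + C - ∑ k, (1 - (c N).errorProb n k) * R k =
      (K + N * C - N * ∑ k, (1 - (c N).errorProb n k) * R k) / N := by
    field_simp
  rw [h6]
  positivity

theorem sum_le_of_mem_capacityRegion (hTIN : ∀ m, TINOptimal (n m))
    {P : Fin M → CyclicPartition K} (hdom : ∀ m, IsDominant (n m) (P m)) {R : Fin K → ℝ}
    (hR : R ∈ capacityRegion n) :
    ∑ k, R k ≤ ((∑ m, partitionBound (n m) (P m) : ℤ) : ℝ) := by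
  have hclosed : IsClosed {R : Fin K → ℝ |
      ∑ k, R k ≤ ((∑ m, partitionBound (n m) (P m) : ℤ) : ℝ)} :=
    isClosed_le (by fun_prop) continuous_const
  exact closure_minimal (fun R hR => Achievable.sum_le hTIN hdom hR) hclosed hR

end ADT

/-! ### Integer duality for the assignment problem -/

section Assignment

variable {ι : Type*} [Fintype ι] [DecidableEq ι]

/-- Egerváry's theorem: integer weights have an integer dual solution of the assignment problem
that is tight on some assignment. -/
theorem exists_potentials_of_assignment (c : ι → ι → ℤ) :
    ∃ (s t : ι → ℤ) (Q : Equiv.Perm ι), (∀ k j, c k j ≤ s j + t k) ∧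
      ∀ j, c (Q j) j = s j + t (Q j) := by
  -- The dual objective is measured from the identity assignment, which makes it a natural number; a
  -- dual optimum then exists by well-ordering.
  let F : ℕ → Prop := fun a => ∃ s t : ι → ℤ, (∀ k j, c k j ≤ s j + t k) ∧
    (∑ i, (s i + t i)) - ∑ i, c i i = a
  have hF : ∃ a, F a := by
    refine ⟨_, fun j => ∑ k, |c k j|, fun _ => 0, fun k j => ?_, (Int.toNat_of_nonneg ?_).symm⟩
    · rw [add_zero]
      exact (le_abs_self _).trans
        (Finset.single_le_sum (f := fun k => |c k j|) (fun _ _ => abs_nonneg _) (Finset.mem_univ k))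
    · rw [sub_nonneg]
      refine Finset.sum_le_sum fun i _ => ?_
      rw [add_zero]
      exact (le_abs_self _).trans
        (Finset.single_le_sum (f := fun k => |c k i|) (fun _ _ => abs_nonneg _) (Finset.mem_univ i))
  classical
  obtain ⟨s, t, hst, hsum⟩ := Nat.find_spec hF
  let T : ι → Finset ι := fun j => Finset.univ.filter fun k => c k j = s j + t k
  -- Hall's condition for the tight edges. If `A` violates it, lowering `s` by one on `A` and
  -- raising `t` by one on its tight neighbours stays feasible, as slack edges have integer slack at
  -- least one, and decreases the minimal objective.
  have hall : ∀ A : Finset ι, A.card ≤ (A.biUnion T).card := by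
    intro A
    by_contra! hA
    let s' : ι → ℤ := fun j => s j - if j ∈ A then 1 else 0
    let t' : ι → ℤ := fun k => t k + if k ∈ A.biUnion T then 1 else 0
    have hfeas : ∀ k j, c k j ≤ s' j + t' k := by
      intro k j
      have h := hst k j
      by_cases hj : j ∈ A
      · by_cases hk : k ∈ A.biUnion T
        · simp only [s', t', if_pos hj, if_pos hk]
          omega
        · have hne : c k j ≠ s j + t k := fun h =>
            hk (Finset.mem_biUnion.2 ⟨j, hj, by simpa [T] using h⟩)
          simp only [s', t', if_pos hj, if_neg hk]
          omega
      · simp only [s', t', if_neg hj]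
        split_ifs <;> omega
    have hsum' : ∑ i, (s' i + t' i) = ∑ i, (s i + t i) - A.card + (A.biUnion T).card := by
      simp only [s', t', Finset.sum_add_distrib, Finset.sum_sub_distrib, Finset.sum_ite_mem,
        Finset.univ_inter, Finset.sum_const, nsmul_eq_mul, mul_one]
      ring
    have hnn : 0 ≤ ∑ i, (s' i + t' i) - ∑ i, c i i := by
      rw [sub_nonneg]
      exact Finset.sum_le_sum fun i _ => hfeas i i
    have hmin := Nat.find_min' hF (m := (∑ i, (s' i + t' i) - ∑ i, c i i).toNat)
      ⟨s', t', hfeas, (Int.toNat_of_nonneg hnn).symm⟩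
    omega
  obtain ⟨f, hf, hfT⟩ := (Finset.all_card_le_biUnion_card_iff_exists_injective T).1 hall
  refine ⟨s, t, Equiv.ofBijective f (Finite.injective_iff_bijective.1 hf), hst, fun j => ?_⟩
  simpa [T] using hfT j

/-- For non-negative weights the dual solution can be chosen non-negative. -/
theorem exists_nonneg_potentials_of_assignment (c : ι → ι → ℕ) :
    ∃ (s t : ι → ℕ) (Q : Equiv.Perm ι), (∀ k j, c k j ≤ s j + t k) ∧
      ∀ j, c (Q j) j = s j + t (Q j) := by
  obtain ⟨s, t, Q, hst, hQ⟩ := exists_potentials_of_assignment fun k j => (c k j : ℤ)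
  rcases isEmpty_or_nonempty ι with hι | hι
  · exact ⟨isEmptyElim, isEmptyElim, Q, isEmptyElim, isEmptyElim⟩
  obtain ⟨k₀, hk₀⟩ := Finite.exists_min t
  -- Moving the minimum of `t` over to `s` keeps all sums; `s` becomes non-negative because the
  -- weights in row `k₀` are.
  have hs : ∀ j, 0 ≤ s j + t k₀ := fun j => (Int.natCast_nonneg _).trans (hst k₀ j)
  have ht : ∀ k, 0 ≤ t k - t k₀ := fun k => sub_nonneg.2 (hk₀ k)
  refine ⟨fun j => (s j + t k₀).toNat, fun k => (t k - t k₀).toNat, Q, fun k j => ?_, fun j => ?_⟩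
  · have := hst k j
    have := hs j
    have := ht k
    dsimp only
    omega
  · have := hQ j
    have := hs j
    have := ht (Q j)
    dsimp only
    omega

end Assignment
namespace ADT

/-! ### Optimal power control -/

/-- The zero diagonal makes the assignment value of a permutation its weight as a cyclic partition.
The dual potentials are power reductions `s` and interference ceilings `t`, and tightness on `Q`
gives total `w(Q)`; optimality of `P` compares it with `Q`. -/
theorem IsOptimal.exists_powerControl {K : ℕ} {n : Fin K → Fin K → ℕ} {P : CyclicPartition K}
    (hopt : IsOptimal n P) :
    ∃ s : Fin K → ℕ, partitionBound n P ≤ ((∑ k, tinBits n s k : ℕ) : ℤ) := by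
  obtain ⟨s, t, Q, hst, hQ⟩ :=
    exists_nonneg_potentials_of_assignment fun k j : Fin K => if k = j then 0 else n k j
  refine ⟨s, (hopt Q).trans ?_⟩
  have hw : weight n Q = ∑ k, (s k + t k) := by
    rw [Finset.sum_add_distrib, ← Equiv.sum_comp Q t, ← Finset.sum_add_distrib]
    exact Finset.sum_congr rfl fun j _ => hQ j
  rw [partitionBound, hw]
  push_cast
  rw [← Finset.sum_sub_distrib]
  refine Finset.sum_le_sum fun k _ => ?_
  have ht : interferenceLevel n s k ≤ t k := Finset.sup_le fun i hi => by
    have := hst k i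
    rw [if_neg (Finset.mem_filter.1 hi).2.symm] at this
    omega
  rw [tinBits]
  omega

end ADT

theorem theorem8 (K M : ℕ) (n : Fin M → Fin K → Fin K → ℕ)
    (hTIN : ∀ m, ADT.TINOptimal (n m))
    (P : Fin M → ADT.CyclicPartition K)
    (hopt : ∀ m, ADT.IsOptimal (n m) (P m))
    (hdom : ∀ m, ADT.IsDominant (n m) (P m)) :
    (∀ m, ADT.InvertibleUnder (n m) (P m)) ∧
      ∃ s : Fin M → Fin K → ℕ,
        ADT.separateTINRate n s ∈ ADT.capacityRegion n ∧
          ADT.IsSumCapacity n (∑ k, ADT.separateTINRate n s k) := by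
  refine ⟨fun m => (hdom m).invertibleUnder, ?_⟩
  choose s hs using fun m => (hopt m).exists_powerControl
  have hmem : ADT.separateTINRate n s ∈ ADT.capacityRegion n :=
    subset_closure (ADT.achievable_separateTINRate n s)
  refine ⟨s, hmem, ⟨_, hmem, rfl⟩, ?_⟩
  rintro _ ⟨R, hR, rfl⟩
  refine (ADT.sum_le_of_mem_capacityRegion hTIN hdom hR).trans ?_
  simp only [ADT.separateTINRate_eq]
  rw [← Nat.cast_sum, Finset.sum_comm]
  have h := Finset.sum_le_sum fun m (_ : m ∈ Finset.univ) => hs m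
  rw [← Nat.cast_sum] at h
  exact_mod_cast h
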